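/- **Theorem 1.** Let $\mathbb{K}\in\{\mathbb{R},\mathbb{C}\}$, let $B_s=\operatorname{diag}(\lambda_1,\dots,\lambda_n)$ be a diagonal matrix with entries $\lambda_i\in\mathbb{K}$, and let $L_{B_s}(\psi)=\sum_{i=1}^n \lambda_i x_i\,\partial\psi/\partial x_i$ be the Lie derivative of formal power series $\psi\in\mathbb{K}[[x_1,\dots,x_n]]$ along the linear vector field $x\mapsto B_s x$. The weight of a monomial $x^\alpha$ is $w(\alpha)=\sum_{j}\alpha_j\lambda_j$, and for $\psi=\sum_\alpha c_\alpha x^\alpha$ and $w\in\mathbb{K}$ the weight-homogeneous component of $\psi$ of weight $w$ is $\psi_w=\sum_{w(\alpha)=w}c_\alpha x^\alpha$. Let $I\subseteq\mathbb{K}[[x_1,\dots,x_n]]$ be an $L_{B_s}$-invariant ideal, i.e. $L_{B_s}(I)\subseteq I$. Then all weight-homogeneous components of elements of $I$ belong to $I$, and $I$ is generated by finitely many of them, which are semi-invariants of $B_s$: there exist $m\in\mathbb{N}_0$, $\varphi_1,\dots,\varphi_m\in\mathbb{K}[[x_1,\dots,x_n]]$ and constants $\nu_1,\dots,\nu_m\in\mathbb{K}$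 such that (a) $I=\langle\varphi_1,\dots,\varphi_m\rangle$; (b) $L_{B_s}(\varphi_j)=\nu_j\,\varphi_j$ for all $1\le j\le m$; (c) for each $1\le j\le m$, $\varphi_j$ is the weight-homogeneous component of weight $\nu_j$ of some element of $I$. -/

import Mathlib

noncomputable section

/-- The linear vector field `x ↦ B x` on the formal power series ring `K[[x_1, …, x_n]]`:
its `i`-th component is the linear form `∑ j, B i j * x_j`. -/
def linearVectorField {K : Type*} [Field K] {n : ℕ} (B : Matrix (Fin n) (Fin n) K) :
    Fin n → MvPowerSeries (Fin n) K :=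
  fun i => ∑ j, MvPowerSeries.C (B i j) * MvPowerSeries.X j

/-- The Lie derivative `L_f(ψ) = D(ψ) · f = ∑ i, (∂ψ/∂x_i) * f_i` of a formal power series `ψ`
with respect to a formal vector field `f`. -/
def lieDerivative {K : Type*} [Field K] {n : ℕ} (f : Fin n → MvPowerSeries (Fin n) K)
    (ψ : MvPowerSeries (Fin n) K) : MvPowerSeries (Fin n) K :=
  ∑ i, MvPowerSeries.pderiv K i ψ * f i

/-- An ideal `I` of `K[[x_1, …, x_n]]` is `L_f`-invariant if `L_f(I) ⊆ I`. -/
def IsLieInvariant {K : Type*} [Field K] {n : ℕ} (f : Fin n → MvPowerSeries (Fin n) K)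
    (I : Ideal (MvPowerSeries (Fin n) K)) : Prop :=
  ∀ ψ ∈ I, lieDerivative f ψ ∈ I

/-- The weight `∑ j, α_j * lam_j` of the monomial `x^α` with respect to `diag(lam)`. -/
def monomialWeight {K : Type*} [Field K] {n : ℕ} (lam : Fin n → K) (α : Fin n →₀ ℕ) : K :=
  ∑ j, (α j : K) * lam j

open Classical in
/-- The weight-homogeneous component of weight `w` of the power series `ψ`: the sum of all terms
`c_α x^α` of `ψ` whose monomial `x^α` has weight `w`. -/
def weightComponent {K : Type*} [Field K] {n : ℕ} (lam : Fin n → K) (w : K)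
    (ψ : MvPowerSeries (Fin n) K) : MvPowerSeries (Fin n) K :=
  fun α => if monomialWeight lam α = w then MvPowerSeries.coeff α ψ else 0

end

/-! `L` acts diagonally on monomials, with the weights as eigenvalues. Below a given degree only
finitely many weights occur, so a polynomial in `L` isolates a single weight there and keeps the
series in `I`. By Krull's intersection theorem `I` is closed in the adic topology, so the exact
component lies in `I`. Closedness also recovers a series from its components; hence they generate
`I`, and Noetherianity leaves finitely many. -/

namespace MvPowerSeries

/-- A power series all of whose terms have degree at least `k` lies in the `k`-th power of the
ideal generated by the variables. -/
theorem mem_span_range_X_pow_of_coeff_eq_zero {σ R : Type*} [Fintype σ] [LinearOrder σ]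
    [CommRing R] (k : ℕ) (f : MvPowerSeries σ R)
    (hf : ∀ α : σ →₀ ℕ, α.degree < k → coeff α f = 0) :
    f ∈ Ideal.span (Set.range (X : σ → MvPowerSeries σ R)) ^ k := by
  classical
  induction k generalizing f with
  | zero => simp
  | succ k ih =>
    -- Each nonconstant monomial is assigned to its smallest variable, so that it is counted exactly
    -- once in `∑ i, X i * g i`.
    let g : σ → MvPowerSeries σ R := fun i β =>
      if (β + Finsupp.single i 1).support.min = (i : WithTop σ) then coeff (β + Finsupp.single i 1) f else 0
    have hg (i : σ) (β : σ →₀ ℕ) : coeff β (g i) =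
      if (β + Finsupp.single i 1).support.min = (i : WithTop σ)
        then coeff (β + Finsupp.single i 1) f else 0 := rfl
    have hfg : f = ∑ i, X i * g i := by
      ext α
      simp only [map_sum, X, coeff_monomial_mul, one_mul, hg]
      rcases eq_or_ne α 0 with rfl | hα
      · rw [hf 0 (by simp)]
        simp
      · obtain ⟨i, hi⟩ := Finset.min_of_nonempty (Finsupp.support_nonempty_iff.mpr hα)
        have hiα : Finsupp.single i 1 ≤ α := by
          rw [Finsupp.single_le_iff]
          exact Nat.one_le_iff_ne_zero.mpr (Finsupp.mem_support_iff.mp (Finset.mem_of_min hi))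
        rw [Finset.sum_eq_single i]
        · rw [if_pos hiα, tsub_add_cancel_of_le hiα, if_pos hi]
        · intro j _ hj
          split_ifs with h₁ h₂
          · rw [tsub_add_cancel_of_le h₁, hi] at h₂
            exact absurd (WithTop.coe_injective h₂).symm hj
          · rfl
          · rfl
        · simp
    rw [hfg, pow_succ']
    refine Ideal.sum_mem _ fun i _ =>
      Ideal.mul_mem_mul (Ideal.subset_span ⟨i, rfl⟩) (ih _ fun β hβ => ?_)
    rw [hg]
    split_ifs
    · exact hf _ (by simpa [map_add] using hβ)
    · rfl

/-- Ideals of a power series ring over a field are closed: a power series that agrees up to every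
finite degree with some element of the ideal belongs to the ideal. -/
theorem mem_ideal_of_forall_exists_coeff_eq {σ k : Type*} [Fintype σ] [LinearOrder σ] [Field k]
    (I : Ideal (MvPowerSeries σ k)) (f : MvPowerSeries σ k)
    (h : ∀ d : ℕ, ∃ g ∈ I, ∀ α : σ →₀ ℕ, α.degree < d → coeff α g = coeff α f) : f ∈ I := by
  have hX : Ideal.span (Set.range (X : σ → MvPowerSeries σ k)) ≠ ⊤ := by
    refine ne_top_of_le_ne_top (RingHom.ker_ne_top (constantCoeff (σ := σ) (R := k))) ?_
    rw [Ideal.span_le]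
    rintro _ ⟨i, rfl⟩
    simp [RingHom.mem_ker]
  -- Krull's intersection theorem for the finite module `K[[x]]/I`: the class of `f` vanishes once
  -- it lies in every power of the span of the variables times the module.
  have hbot := Ideal.iInf_pow_smul_eq_bot_of_isLocalRing
    (M := MvPowerSeries σ k ⧸ I) _ hX
  rw [← Ideal.Quotient.eq_zero_iff_mem, ← Submodule.mem_bot (R := MvPowerSeries σ k), ← hbot,
    Submodule.mem_iInf]
  intro d
  obtain ⟨g, hgI, hg⟩ := h d
  have hfg : f - g ∈ Ideal.span (Set.range (X : σ → MvPowerSeries σ k)) ^ d :=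
    mem_span_range_X_pow_of_coeff_eq_zero d _ fun α hα => by rw [map_sub, hg α hα, sub_self]
  have hquot : Ideal.Quotient.mk I f = (f - g) • (1 : MvPowerSeries σ k ⧸ I) := by
    change _ = Ideal.Quotient.mk I ((f - g) * 1)
    rw [mul_one, map_sub, Ideal.Quotient.eq_zero_iff_mem.mpr hgI, sub_zero]
  rw [hquot]
  exact Submodule.smul_mem_smul hfg Submodule.mem_top

end MvPowerSeries

open MvPowerSeries

section

variable {K : Type*} [Field K] {n : ℕ} (lam : Fin n → K)

theorem coeff_weightComponent [DecidableEq K] (w : K) (ψ : MvPowerSeries (Fin n) K)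
    (α : Fin n →₀ ℕ) :
    coeff α (weightComponent lam w ψ) = if monomialWeight lam α = w then coeff α ψ else 0 := by
  change @ite _ _ (Classical.propDecidable _) _ _ = _
  congr

theorem linearVectorField_diagonal (i : Fin n) :
    linearVectorField (Matrix.diagonal lam) i = C (lam i) * X i := by
  rw [linearVectorField, Finset.sum_eq_single i]
  · simp
  · intro j _ hj
    simp [Matrix.diagonal_apply_ne _ hj.symm]
  · simp

/-- The Lie derivative along a diagonal linear vector field multiplies each monomial by its
weight. -/
theorem coeff_lieDerivative_diagonal (ψ : MvPowerSeries (Fin n) K) (α : Fin n →₀ ℕ) :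
    coeff α (lieDerivative (linearVectorField (Matrix.diagonal lam)) ψ) =
      monomialWeight lam α * coeff α ψ := by
  classical
  simp only [lieDerivative, monomialWeight, map_sum, linearVectorField_diagonal, Finset.sum_mul]
  refine Finset.sum_congr rfl fun i _ => ?_
  rw [mul_left_comm, coeff_C_mul, X, coeff_mul_monomial]
  split_ifs with h
  · have h' : 1 ≤ α i := Finsupp.single_le_iff.mp h
    rw [coeff_pderiv, tsub_add_cancel_of_le h]
    simp only [Finsupp.tsub_apply, Finsupp.single_eq_same, Nat.cast_sub h', Nat.cast_one]
    ring
  · have h' : α i = 0 := by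
      rw [Finsupp.single_le_iff] at h
      omega
    simp [h']

theorem lieDerivative_weightComponent (w : K) (ψ : MvPowerSeries (Fin n) K) :
    lieDerivative (linearVectorField (Matrix.diagonal lam)) (weightComponent lam w ψ) =
      C w * weightComponent lam w ψ := by
  classical
  ext α
  rw [coeff_lieDerivative_diagonal, coeff_C_mul, coeff_weightComponent]
  split_ifs with h
  · rw [h]
  · simp

/-- Monomials of degree less than `d` have only finitely many weights. -/
theorem exists_finset_monomialWeight_mem (d : ℕ) :
    ∃ S : Finset K, ∀ α : Fin n →₀ ℕ, α.degree < d → monomialWeight lam α ∈ S := by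
  have hfin : {α : Fin n →₀ ℕ | α.degree < d}.Finite :=
    Finsupp.finite_of_degree_lt d
  exact ⟨(hfin.image (monomialWeight lam)).toFinset, fun α hα =>
    (Set.Finite.mem_toFinset _).mpr ⟨α, hα, rfl⟩⟩

variable {lam} {I : Ideal (MvPowerSeries (Fin n) K)}

/-- Applying a product of operators `(L - v) / (w - v)` to an element of an invariant ideal. -/
theorem IsLieInvariant.exists_mem_coeff_eq_prod
    (hI : IsLieInvariant (linearVectorField (Matrix.diagonal lam)) I)
    {ψ : MvPowerSeries (Fin n) K} (hψ : ψ ∈ I) (w : K) (S : Finset K) :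
    ∃ g ∈ I, ∀ α, coeff α g = (∏ v ∈ S, (monomialWeight lam α - v) / (w - v)) * coeff α ψ := by
  classical
  induction S using Finset.induction_on with
  | empty => exact ⟨ψ, hψ, by simp⟩
  | insert v S hv ih =>
    obtain ⟨g, hgI, hg⟩ := ih
    refine ⟨C (w - v)⁻¹ * (lieDerivative (linearVectorField (Matrix.diagonal lam)) g - C v * g),
      I.mul_mem_left _ (I.sub_mem (hI g hgI) (I.mul_mem_left _ hgI)), fun α => ?_⟩
    rw [coeff_C_mul, map_sub, coeff_lieDerivative_diagonal, coeff_C_mul, hg,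
      Finset.prod_insert hv, div_eq_mul_inv]
    ring

theorem IsLieInvariant.weightComponent_mem
    (hI : IsLieInvariant (linearVectorField (Matrix.diagonal lam)) I)
    {ψ : MvPowerSeries (Fin n) K} (hψ : ψ ∈ I) (w : K) : weightComponent lam w ψ ∈ I := by
  classical
  refine mem_ideal_of_forall_exists_coeff_eq I _ fun d => ?_
  obtain ⟨S, hS⟩ := exists_finset_monomialWeight_mem lam d
  -- Lagrange interpolation: the product is 1 at `w` and 0 at the other weights in `S`. Erasing `w`
  -- avoids the factor with denominator `w - w`.
  obtain ⟨g, hgI, hg⟩ := hI.exists_mem_coeff_eq_prod hψ w (S.erase w)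
  refine ⟨g, hgI, fun α hα => ?_⟩
  rw [hg, coeff_weightComponent]
  split_ifs with h
  · rw [h, Finset.prod_eq_one, one_mul]
    intro v hv
    exact div_self (sub_ne_zero.mpr (Finset.ne_of_mem_erase hv).symm)
  · rw [Finset.prod_eq_zero (Finset.mem_erase.mpr ⟨h, hS α hα⟩) (by simp), zero_mul]

/-- A power series lies in every ideal that contains all of its weight-homogeneous components. -/
theorem mem_of_forall_weightComponent_mem {ψ : MvPowerSeries (Fin n) K}
    (h : ∀ w, weightComponent lam w ψ ∈ I) : ψ ∈ I := by
  classical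
  refine mem_ideal_of_forall_exists_coeff_eq I _ fun d => ?_
  obtain ⟨S, hS⟩ := exists_finset_monomialWeight_mem lam d
  refine ⟨∑ w ∈ S, weightComponent lam w ψ, I.sum_mem fun w _ => h w, fun α hα => ?_⟩
  simp [coeff_weightComponent, hS α hα]

end

theorem theorem1 {K : Type*} [RCLike K] (n : ℕ) (lam : Fin n → K)
    (I : Ideal (MvPowerSeries (Fin n) K))
    (hI : IsLieInvariant (linearVectorField (Matrix.diagonal lam)) I) :
    (∀ ψ ∈ I, ∀ w : K, weightComponent lam w ψ ∈ I) ∧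
    ∃ (m : ℕ) (φ : Fin m → MvPowerSeries (Fin n) K) (ν : Fin m → K),
      I = Ideal.span (Set.range φ) ∧
      (∀ j, lieDerivative (linearVectorField (Matrix.diagonal lam)) (φ j)
        = MvPowerSeries.C (ν j) * φ j) ∧
      (∀ j, ∃ ψ ∈ I, φ j = weightComponent lam (ν j) ψ) := by
  refine ⟨fun ψ hψ w => hI.weightComponent_mem hψ w, ?_⟩
  let G : Set (MvPowerSeries (Fin n) K) := {φ | ∃ w, ∃ ψ ∈ I, φ = weightComponent lam w ψ}
  have hIG : I = Ideal.span G := by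
    refine le_antisymm (fun ψ hψ => ?_) (Ideal.span_le.mpr ?_)
    · exact mem_of_forall_weightComponent_mem fun w => Ideal.subset_span ⟨w, ψ, hψ, rfl⟩
    · rintro _ ⟨w, ψ, hψ, rfl⟩
      exact hI.weightComponent_mem hψ w
  -- The finite generating set must be chosen inside `G`, so that every generator is itself a weight
  -- component.
  obtain ⟨T, hTG, hT⟩ := (Submodule.fg_span_iff_fg_span_finset_subset G).mp
    (IsNoetherian.noetherian (Ideal.span G))
  choose ν hν using fun j : Fin T.card => hTG (T.equivFin.symm j).2
  refine ⟨T.card, fun j => T.equivFin.symm j, ν, ?_, fun j => ?_, hν⟩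
  · have hrange : Set.range (fun j => (T.equivFin.symm j : MvPowerSeries (Fin n) K)) = T := by
      rw [← Function.comp_def, T.equivFin.symm.surjective.range_comp, Subtype.range_coe]
    rw [hrange]
    exact hIG.trans hT
  · obtain ⟨ψ, -, hψ⟩ := hν j
    simp only [hψ]
    exact lieDerivative_weightComponent lam (ν j) ψ
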